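/- An additively idempotent semiring (ai-semiring) is an algebra $(S,+,\cdot)$ with two binary operations such that $(S,+)$ is a commutative idempotent semigroup, $(S,\cdot)$ is a semigroup, and multiplication distributes over addition on both sides. The variety $\mathsf V(A)$ generated by an algebra $A$ is the smallest class of algebras (of the same type) that contains $A$ and is closed under subalgebras, homomorphic images and direct products. The algebra $A$ is nonfinitely based if $\mathsf V(A)$ cannot be defined by finitely many identities. An algebra is a subdirect product of $B$ and $C$ if it is a subalgebra of $B\times C$ that projects onto both factors. Let $S_7$ and $S_{53}$ be the algebras on $\{\infty,a,1\}$ with the following operations (rows and columns are in the order $\infty,a,1$; the two have the same multiplication): \[ +_{S_7}:\begin{pmatrix}\infty&\infty&\infty\\ \infty&a&\infty\\ \infty&\infty&1\end{pmatrix},\quad +_{S_{53}}:\begin{pmatrix}\infty&\infty&\infty\\ \infty&a&a\\ \infty&a&1\end{pmatrix},\quad \cdot:\begin{pmatrix}\infty&\infty&\infty\\ \infty&\infty&a\\ \infty&a&1\end{pmatrix}. \] Let $S_{(4,123)}$ and $S_{(4,359)}$ be the algebras on $\{\infty,a,1,b\}$ with the following operations (rows and columns are in the order $\infty,a,1,b$):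 \[ S_{(4,123)}:\quad +=\begin{pmatrix}\infty&\infty&\infty&\infty\\ \infty&a&\infty&\infty\\ \infty&\infty&1&b\\ \infty&\infty&b&b\end{pmatrix},\quad \cdot=\begin{pmatrix}\infty&\infty&\infty&\infty\\ \infty&\infty&a&\infty\\ \infty&a&1&b\\ \infty&\infty&b&\infty\end{pmatrix}, \] \[ S_{(4,359)}:\quad +=\begin{pmatrix}\infty&\infty&\infty&b\\ \infty&a&\infty&b\\ \infty&\infty&1&b\\ b&b&b&b\end{pmatrix},\quad \cdot=\begin{pmatrix}b&b&\infty&b\\ b&b&a&b\\ \infty&a&1&b\\ b&b&b&b\end{pmatrix}. \] Then these four algebras are ai-semirings, $S_{(4,359)}$ is nonfinitely based, and both $S_{(4,359)}$ and $S_{(4,123)}$ are isomorphic to subdirect products of $S_7$ and $S_{53}$; consequently $\mathsf V(S_{(4,359)})=\mathsf V(S_{(4,123)})$. -/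

import Mathlib

universe u v w

namespace AiSR

/-- A map between algebras with two binary operations that preserves both operations. -/
def IsHom {A : Type u} {B : Type v} [Add A] [Mul A] [Add B] [Mul B] (f : A → B) : Prop :=
  (∀ x y, f (x + y) = f x + f y) ∧ (∀ x y, f (x * y) = f x * f y)

/-- Additively idempotent semirings: `(S, +)` is a commutative idempotent semigroup, `(S, *)` is a
semigroup, and multiplication distributes over addition on both sides. -/
structure IsAiSemiring (S : Type u) [Add S] [Mul S] : Prop where
  add_assoc : ∀ x y z : S, x + y + z = x + (y + z)
  add_comm : ∀ x y : S, x + y = y + x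
  add_idem : ∀ x : S, x + x = x
  mul_assoc : ∀ x y z : S, x * y * z = x * (y * z)
  right_distrib : ∀ x y z : S, (x + y) * z = x * z + y * z
  left_distrib : ∀ x y z : S, x * (y + z) = x * y + x * z

/-- An algebra with two binary operations `+` and `*` on a nonempty carrier (no laws are imposed). -/
structure Alg : Type (u + 1) where
  carrier : Type u
  [nonempty : Nonempty carrier]
  [add : Add carrier]
  [mul : Mul carrier]

attribute [instance] Alg.nonempty Alg.add Alg.mul

/-- The direct product of a family of algebras, with componentwise operations. -/
def Alg.pi {ι : Type u} (A : ι → Alg.{u}) : Alg.{u} where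
  carrier := ∀ i, (A i).carrier

/-- A variety is a class of algebras closed under (isomorphic copies of) subalgebras, homomorphic
images and arbitrary direct products. -/
structure IsVariety (K : Set Alg.{u}) : Prop where
  sub : ∀ A ∈ K, ∀ (B : Alg.{u}) (f : B.carrier → A.carrier),
    IsHom f → Function.Injective f → B ∈ K
  image : ∀ A ∈ K, ∀ (B : Alg.{u}) (f : A.carrier → B.carrier),
    IsHom f → Function.Surjective f → B ∈ K
  prod : ∀ (ι : Type u) (A : ι → Alg.{u}), (∀ i, A i ∈ K) → Alg.pi A ∈ K

/-- The variety generated by the algebra `A`: the smallest variety that contains `A`. -/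
def varietyOf (A : Type u) [Nonempty A] [Add A] [Mul A] : Set Alg.{u} :=
  {B | ∀ K : Set Alg.{u}, IsVariety K → (⟨A⟩ : Alg.{u}) ∈ K → B ∈ K}

/-- Terms in the operations `+` and `*` over countably many variables. -/
inductive SRTerm : Type
  | var : ℕ → SRTerm
  | add : SRTerm → SRTerm → SRTerm
  | mul : SRTerm → SRTerm → SRTerm

/-- The value of a term under an assignment of the variables. -/
def SRTerm.eval {A : Type u} [Add A] [Mul A] (φ : ℕ → A) : SRTerm → A
  | .var n => φ n
  | .add s t => s.eval φ + t.eval φ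
  | .mul s t => s.eval φ * t.eval φ

/-- The algebra `A` satisfies the identity `e.1 ≈ e.2`. -/
def Satisfies (A : Type u) [Add A] [Mul A] (e : SRTerm × SRTerm) : Prop :=
  ∀ φ : ℕ → A, e.1.eval φ = e.2.eval φ

/-- The class `K` is defined by finitely many identities. -/
def IsFinitelyBasedClass (K : Set Alg.{u}) : Prop :=
  ∃ E : Set (SRTerm × SRTerm), E.Finite ∧ K = {B | ∀ e ∈ E, Satisfies B.carrier e}

/-- The algebra `A` is finitely based: the variety generated by `A` is defined by finitely many
identities. -/
def IsFinitelyBased (A : Type u) [Nonempty A] [Add A] [Mul A] : Prop :=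
  IsFinitelyBasedClass (varietyOf A)

/-- `A` is isomorphic to a subdirect product of `B` and `C`, that is, to a subalgebra of `B × C`
that both projections map onto the factors. -/
def IsSubdirectProduct (A : Type u) (B : Type v) (C : Type w) [Add A] [Mul A] [Add B] [Mul B]
    [Add C] [Mul C] : Prop :=
  ∃ f : A → B × C, IsHom f ∧ Function.Injective f ∧
    Function.Surjective (fun x => (f x).1) ∧ Function.Surjective (fun x => (f x).2)

/-- The carrier `{∞, a, 1}` of the semiring `S_7`. -/
inductive S7 : Type
  | inf
  | a
  | one
  deriving DecidableEq

instance : Nonempty S7 := ⟨.inf⟩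

instance : Add S7 where
  add x y := match x, y with
    | .inf, .inf => .inf | .inf, .a => .inf | .inf, .one => .inf
    | .a, .inf => .inf | .a, .a => .a | .a, .one => .inf
    | .one, .inf => .inf | .one, .a => .inf | .one, .one => .one

instance : Mul S7 where
  mul x y := match x, y with
    | .inf, .inf => .inf | .inf, .a => .inf | .inf, .one => .inf
    | .a, .inf => .inf | .a, .a => .inf | .a, .one => .a
    | .one, .inf => .inf | .one, .a => .a | .one, .one => .one

/-- The carrier `{∞, a, 1}` of the semiring `S_53`. -/
inductive S53 : Type
  | inf
  | a
  | one
  deriving DecidableEq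

instance : Nonempty S53 := ⟨.inf⟩

instance : Add S53 where
  add x y := match x, y with
    | .inf, .inf => .inf | .inf, .a => .inf | .inf, .one => .inf
    | .a, .inf => .inf | .a, .a => .a | .a, .one => .a
    | .one, .inf => .inf | .one, .a => .a | .one, .one => .one

instance : Mul S53 where
  mul x y := match x, y with
    | .inf, .inf => .inf | .inf, .a => .inf | .inf, .one => .inf
    | .a, .inf => .inf | .a, .a => .inf | .a, .one => .a
    | .one, .inf => .inf | .one, .a => .a | .one, .one => .one

/-- The carrier `{∞, a, 1, b}` of the semiring `S_(4,123)`. -/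
inductive S4_123 : Type
  | inf
  | a
  | one
  | b
  deriving DecidableEq

instance : Nonempty S4_123 := ⟨.inf⟩

instance : Add S4_123 where
  add x y := match x, y with
    | .inf, .inf => .inf | .inf, .a => .inf | .inf, .one => .inf | .inf, .b => .inf
    | .a, .inf => .inf | .a, .a => .a | .a, .one => .inf | .a, .b => .inf
    | .one, .inf => .inf | .one, .a => .inf | .one, .one => .one | .one, .b => .b
    | .b, .inf => .inf | .b, .a => .inf | .b, .one => .b | .b, .b => .b

instance : Mul S4_123 where
  mul x y := match x, y with
    | .inf, .inf => .inf | .inf, .a => .inf | .inf, .one => .inf | .inf, .b => .inf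
    | .a, .inf => .inf | .a, .a => .inf | .a, .one => .a | .a, .b => .inf
    | .one, .inf => .inf | .one, .a => .a | .one, .one => .one | .one, .b => .b
    | .b, .inf => .inf | .b, .a => .inf | .b, .one => .b | .b, .b => .inf

/-- The carrier `{∞, a, 1, b}` of the semiring `S_(4,359)`. -/
inductive S4_359 : Type
  | inf
  | a
  | one
  | b
  deriving DecidableEq

instance : Nonempty S4_359 := ⟨.inf⟩

instance : Add S4_359 where
  add x y := match x, y with
    | .inf, .inf => .inf | .inf, .a => .inf | .inf, .one => .inf | .inf, .b => .b
    | .a, .inf => .inf | .a, .a => .a | .a, .one => .inf | .a, .b => .b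
    | .one, .inf => .inf | .one, .a => .inf | .one, .one => .one | .one, .b => .b
    | .b, .inf => .b | .b, .a => .b | .b, .one => .b | .b, .b => .b

instance : Mul S4_359 where
  mul x y := match x, y with
    | .inf, .inf => .b | .inf, .a => .b | .inf, .one => .inf | .inf, .b => .b
    | .a, .inf => .b | .a, .a => .b | .a, .one => .a | .a, .b => .b
    | .one, .inf => .inf | .one, .a => .a | .one, .one => .one | .one, .b => .b
    | .b, .inf => .b | .b, .a => .b | .b, .one => .b | .b, .b => .b

end AiSR

namespace AiSR

/-! ### Homomorphisms, identities and varieties -/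

/-! Both four-element algebras are subdirect products of `S7` and `S53`, so a variety contains
either one iff it contains both factors, and their identities are those common to `S7` and `S53`. It
remains to find, for any finite set of common identities, an algebra that satisfies them but
violates another common identity.

Give the variables weights. On finite sets of commutative monomials, `S7` then records whether all
weights are 0, all are 1, or neither; `S53` whether all are 0, all are at most 1, or neither. For
odd `N` take the edges `xᵢxᵢ₊₁` with `i < N` and the closing monomial `x₀x_Nx_{N+1}`. If all of
these weigh 1, weights alternate along the path and `x₀x_N` weighs 1; if all weigh at most 1, so
does `x₀x_N`, a divisor of the closing monomial. Hence adjoining `x₀x_N` is a common identity.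

No other new monomial is forced (`mem_cycleSet_or_eq`), and once a path edge is dropped `x₀x_N` is
not forced either (`exists_weight_eq_one`). So the syntactic quotient `CycleAlg N` satisfies every
common identity that is short relative to `N` (`CycleAlg.satisfies`), but not the cycle identity. -/

theorem IsHom.eval {A : Type u} {B : Type v} [Add A] [Mul A] [Add B] [Mul B] {f : A → B}
    (hf : IsHom f) (φ : ℕ → A) (t : SRTerm) : f (t.eval φ) = t.eval (fun n => f (φ n)) := by
  induction t with
  | var n => rfl
  | add s t hs ht => simp only [SRTerm.eval, hf.1, hs, ht]
  | mul s t hs ht => simp only [SRTerm.eval, hf.2, hs, ht]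

theorem Satisfies.of_injective {A : Type u} {B : Type v} [Add A] [Mul A] [Add B] [Mul B]
    {f : B → A} (hf : IsHom f) (hi : Function.Injective f) {e : SRTerm × SRTerm}
    (h : Satisfies A e) : Satisfies B e := fun φ => hi <| by
  rw [hf.eval, hf.eval]; exact h _

theorem Satisfies.of_surjective {A : Type u} {B : Type v} [Add A] [Mul A] [Add B] [Mul B]
    {f : A → B} (hf : IsHom f) (hs : Function.Surjective f) {e : SRTerm × SRTerm}
    (h : Satisfies A e) : Satisfies B e := fun φ => by
  obtain ⟨ψ, hψ⟩ := hs.comp_left φ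
  have := congrArg f (h ψ)
  rw [hf.eval, hf.eval] at this
  rw [← hψ]
  exact this

theorem eval_pi {ι : Type u} (A : ι → Alg.{u}) (φ : ℕ → (Alg.pi A).carrier) (t : SRTerm) (i : ι) :
    (t.eval φ : (Alg.pi A).carrier) i = t.eval (fun n => φ n i) :=
  IsHom.eval (f := fun x : (Alg.pi A).carrier => x i) ⟨fun _ _ => rfl, fun _ _ => rfl⟩ φ t

theorem isVariety_satisfies (e : SRTerm × SRTerm) :
    IsVariety {B : Alg.{u} | Satisfies B.carrier e} where
  sub _ hA _ _ hf hi := Satisfies.of_injective hf hi hA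
  image _ hA _ _ hf hs := Satisfies.of_surjective hf hs hA
  prod _ A hA := fun φ => funext fun i => by
    rw [eval_pi, eval_pi]; exact hA i _

theorem mem_varietyOf_self (A : Type u) [Nonempty A] [Add A] [Mul A] :
    (⟨A⟩ : Alg.{u}) ∈ varietyOf A := fun _ _ h => h

theorem satisfies_of_mem_varietyOf {A : Type u} [Nonempty A] [Add A] [Mul A] {B : Alg.{u}}
    (hB : B ∈ varietyOf A) {e : SRTerm × SRTerm} (h : Satisfies A e) : Satisfies B.carrier e :=
  hB _ (isVariety_satisfies e) h

theorem IsSubdirectProduct.satisfies_iff {A : Type u} {B : Type v} {C : Type w} [Add A] [Mul A]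
    [Add B] [Mul B] [Add C] [Mul C] (h : IsSubdirectProduct A B C) (e : SRTerm × SRTerm) :
    Satisfies A e ↔ Satisfies B e ∧ Satisfies C e := by
  obtain ⟨f, hf, hi, h1, h2⟩ := h
  have hf1 : IsHom fun x => (f x).1 :=
    ⟨fun x y => by simp only [hf.1, Prod.fst_add], fun x y => by simp only [hf.2, Prod.fst_mul]⟩
  have hf2 : IsHom fun x => (f x).2 :=
    ⟨fun x y => by simp only [hf.1, Prod.snd_add], fun x y => by simp only [hf.2, Prod.snd_mul]⟩
  refine ⟨fun hA => ⟨hA.of_surjective hf1 h1, hA.of_surjective hf2 h2⟩, fun hBC φ => hi ?_⟩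
  refine Prod.ext ?_ ?_
  · exact (hf1.eval φ e.1).trans ((hBC.1 _).trans (hf1.eval φ e.2).symm)
  · exact (hf2.eval φ e.1).trans ((hBC.2 _).trans (hf2.eval φ e.2).symm)

theorem IsSubdirectProduct.mem_iff {A B C : Type} [Nonempty A] [Nonempty B] [Nonempty C]
    [Add A] [Mul A] [Add B] [Mul B] [Add C] [Mul C] (h : IsSubdirectProduct A B C)
    {K : Set Alg.{0}} (hK : IsVariety K) :
    (⟨A⟩ : Alg) ∈ K ↔ (⟨B⟩ : Alg) ∈ K ∧ (⟨C⟩ : Alg) ∈ K := by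
  obtain ⟨f, hf, hi, h1, h2⟩ := h
  constructor
  · intro hA
    exact ⟨hK.image _ hA ⟨B⟩ (fun x => (f x).1)
        ⟨fun x y => congrArg Prod.fst (hf.1 x y), fun x y => congrArg Prod.fst (hf.2 x y)⟩ h1,
      hK.image _ hA ⟨C⟩ (fun x => (f x).2)
        ⟨fun x y => congrArg Prod.snd (hf.1 x y), fun x y => congrArg Prod.snd (hf.2 x y)⟩ h2⟩
  · rintro ⟨hB, hC⟩
    let F : Bool → Alg.{0} := fun i => Bool.rec ⟨B⟩ ⟨C⟩ i
    have hF : Alg.pi F ∈ K := hK.prod Bool F (by rintro (_ | _) <;> assumption)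
    refine hK.sub _ hF ⟨A⟩ (fun x i => Bool.rec (f x).1 (f x).2 i) ⟨?_, ?_⟩ ?_
    · intro x y
      funext i
      cases i
      · exact congrArg Prod.fst (hf.1 x y)
      · exact congrArg Prod.snd (hf.1 x y)
    · intro x y
      funext i
      cases i
      · exact congrArg Prod.fst (hf.2 x y)
      · exact congrArg Prod.snd (hf.2 x y)
    · intro x y hxy
      exact hi (Prod.ext (congrFun hxy false) (congrFun hxy true))

/-! ### The four semirings -/

theorem isAiSemiring_S7 : IsAiSemiring S7 := by
  constructor <;> (repeat' rintro (_ | _)) <;> rfl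

theorem isAiSemiring_S53 : IsAiSemiring S53 := by
  constructor <;> (repeat' rintro (_ | _)) <;> rfl

theorem isSubdirectProduct_S4_359 : IsSubdirectProduct S4_359 S7 S53 := by
  refine ⟨fun x => match x with
    | .inf => (.inf, .a) | .a => (.a, .a) | .one => (.one, .one) | .b => (.inf, .inf),
    ⟨?_, ?_⟩, ?_, ?_, ?_⟩
  · rintro (_ | _) (_ | _) <;> rfl
  · rintro (_ | _) (_ | _) <;> rfl
  · rintro (_ | _) (_ | _) h <;> first | rfl | simp at h
  · rintro (_ | _)
    exacts [⟨.inf, rfl⟩, ⟨.a, rfl⟩, ⟨.one, rfl⟩]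
  · rintro (_ | _)
    exacts [⟨.b, rfl⟩, ⟨.a, rfl⟩, ⟨.one, rfl⟩]

theorem isSubdirectProduct_S4_123 : IsSubdirectProduct S4_123 S7 S53 := by
  refine ⟨fun x => match x with
    | .inf => (.inf, .inf) | .a => (.a, .inf) | .one => (.one, .one) | .b => (.inf, .a),
    ⟨?_, ?_⟩, ?_, ?_, ?_⟩
  · rintro (_ | _) (_ | _) <;> rfl
  · rintro (_ | _) (_ | _) <;> rfl
  · rintro (_ | _) (_ | _) h <;> first | rfl | simp at h
  · rintro (_ | _)
    exacts [⟨.inf, rfl⟩, ⟨.a, rfl⟩, ⟨.one, rfl⟩]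
  · rintro (_ | _)
    exacts [⟨.inf, rfl⟩, ⟨.b, rfl⟩, ⟨.one, rfl⟩]

theorem IsSubdirectProduct.isAiSemiring {A : Type u} {B : Type v} {C : Type w} [Add A] [Mul A]
    [Add B] [Mul B] [Add C] [Mul C] (h : IsSubdirectProduct A B C) (hB : IsAiSemiring B)
    (hC : IsAiSemiring C) : IsAiSemiring A := by
  obtain ⟨f, hf, hi, -, -⟩ := h
  constructor <;> intros <;> apply hi <;> simp only [hf.1, hf.2] <;> ext1 <;>
    simp only [Prod.fst_add, Prod.fst_mul, Prod.snd_add, Prod.snd_mul]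
  exacts [hB.add_assoc _ _ _, hC.add_assoc _ _ _, hB.add_comm _ _, hC.add_comm _ _,
    hB.add_idem _, hC.add_idem _, hB.mul_assoc _ _ _, hC.mul_assoc _ _ _,
    hB.right_distrib _ _ _, hC.right_distrib _ _ _, hB.left_distrib _ _ _, hC.left_distrib _ _ _]

/-! ### Finite sets of commutative monomials -/

/-- Nonempty finite sets of commutative monomials over the variables `ℕ`. -/
structure MonSet : Type where
  /-- The underlying set of monomials. -/
  supp : Finset (Multiset ℕ)
  nonempty : supp.Nonempty

instance : Add MonSet := ⟨fun S T => ⟨S.supp ∪ T.supp, S.nonempty.inl⟩⟩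

instance : Mul MonSet :=
  ⟨fun S T => ⟨Finset.image₂ (· + ·) S.supp T.supp, S.nonempty.image₂ T.nonempty⟩⟩

/-- The set that consists of one monomial. -/
def MonSet.single (m : Multiset ℕ) : MonSet := ⟨{m}, Finset.singleton_nonempty m⟩

theorem MonSet.supp_add (S T : MonSet) : (S + T).supp = S.supp ∪ T.supp := rfl

theorem MonSet.supp_mul (S T : MonSet) :
    (S * T).supp = Finset.image₂ (· + ·) S.supp T.supp := rfl

theorem MonSet.mem_mul {S T : MonSet} {m : Multiset ℕ} :
    m ∈ (S * T).supp ↔ ∃ s ∈ S.supp, ∃ t ∈ T.supp, s + t = m := by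
  rw [MonSet.supp_mul, Finset.mem_image₂]

/-- The total weight of a monomial. -/
def weight (f : ℕ → ℕ) (m : Multiset ℕ) : ℕ := (m.map f).sum

theorem weight_add (f : ℕ → ℕ) (m n : Multiset ℕ) :
    weight f (m + n) = weight f m + weight f n := by
  simp [weight]

theorem weight_cons (f : ℕ → ℕ) (i : ℕ) (m : Multiset ℕ) :
    weight f (i ::ₘ m) = f i + weight f m := by
  simp [weight]

/-- All monomials of the set have weight `k`. -/
def MonSet.AllEq (f : ℕ → ℕ) (k : ℕ) (T : MonSet) : Prop := ∀ t ∈ T.supp, weight f t = k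

/-- All monomials of the set have weight at most `1`. -/
def MonSet.AllLe (f : ℕ → ℕ) (T : MonSet) : Prop := ∀ t ∈ T.supp, weight f t ≤ 1

variable {f : ℕ → ℕ} {S T : MonSet}

theorem MonSet.allEq_add {k : ℕ} : (S + T).AllEq f k ↔ S.AllEq f k ∧ T.AllEq f k := by
  simp only [AllEq, supp_add, Finset.forall_mem_union]

theorem MonSet.allLe_add : (S + T).AllLe f ↔ S.AllLe f ∧ T.AllLe f := by
  simp only [AllLe, supp_add, Finset.forall_mem_union]

theorem MonSet.forall_mul {P : ℕ → Prop} : (∀ t ∈ (S * T).supp, P (weight f t)) ↔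
    ∀ s ∈ S.supp, ∀ t ∈ T.supp, P (weight f s + weight f t) := by
  simp only [supp_mul, Finset.forall_mem_image₂, weight_add]

theorem MonSet.AllEq.not_zero_one (h0 : S.AllEq f 0) (h1 : S.AllEq f 1) : False := by
  obtain ⟨s, hs⟩ := S.nonempty
  have := h0 s hs
  have := h1 s hs
  omega

theorem MonSet.AllEq.allLe (h : S.AllEq f 0) : S.AllLe f := fun s hs => by
  rw [h s hs]; omega

theorem MonSet.allEq_zero_mul : (S * T).AllEq f 0 ↔ S.AllEq f 0 ∧ T.AllEq f 0 := by
  rw [AllEq, forall_mul (P := (· = 0))]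
  obtain ⟨s, hs⟩ := S.nonempty
  obtain ⟨t, ht⟩ := T.nonempty
  refine ⟨fun h => ⟨fun x hx => ?_, fun x hx => ?_⟩, fun h x hx y hy => ?_⟩
  · have := h x hx t ht; omega
  · have := h s hs x hx; omega
  · have := h.1 x hx; have := h.2 y hy; omega

/-- If all sums of a weight from `S` and a weight from `T` equal 1, the weights are constant on each
factor, and 1 splits only as 0 + 1 or 1 + 0. This is the multiplication table of `S7`. -/
theorem MonSet.allEq_one_mul : (S * T).AllEq f 1 ↔
    S.AllEq f 0 ∧ T.AllEq f 1 ∨ S.AllEq f 1 ∧ T.AllEq f 0 := by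
  rw [AllEq, forall_mul (P := (· = 1))]
  obtain ⟨s, hs⟩ := S.nonempty
  obtain ⟨t, ht⟩ := T.nonempty
  constructor
  · intro h
    have h0 := h s hs t ht
    rcases Nat.eq_zero_or_pos (weight f s) with h1 | h1
    · refine Or.inl ⟨fun x hx => ?_, fun y hy => ?_⟩
      · have := h x hx t ht; omega
      · have := h s hs y hy; omega
    · refine Or.inr ⟨fun x hx => ?_, fun y hy => ?_⟩
      · have := h x hx t ht; omega
      · have := h s hs y hy; omega
  · rintro (h | h) x hx y hy <;>
    · have := h.1 x hx; have := h.2 y hy; omega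

theorem MonSet.allLe_mul : (S * T).AllLe f ↔
    S.AllEq f 0 ∧ T.AllLe f ∨ S.AllLe f ∧ T.AllEq f 0 := by
  rw [AllLe, forall_mul (P := (· ≤ 1))]
  obtain ⟨s, hs⟩ := S.nonempty
  obtain ⟨t, ht⟩ := T.nonempty
  constructor
  · intro h
    by_cases h1 : S.AllEq f 0
    · refine Or.inl ⟨h1, fun y hy => ?_⟩
      have := h s hs y hy; omega
    -- A single `r` in `S` of positive weight forces all of `T` to weigh 0.
    · unfold AllEq at h1
      push Not at h1
      obtain ⟨r, hr, h1⟩ := h1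
      refine Or.inr ⟨fun x hx => ?_, fun y hy => ?_⟩
      · have := h x hx t ht; omega
      · have := h r hr y hy; omega
  · rintro (h | h) x hx y hy <;>
    · have := h.1 x hx; have := h.2 y hy; omega

open Classical in
/-- The homomorphism to `S_7` given by a weight function. -/
noncomputable def toS7 (f : ℕ → ℕ) (T : MonSet) : S7 :=
  if T.AllEq f 0 then .one else if T.AllEq f 1 then .a else .inf

open Classical in
/-- The homomorphism to `S_53` given by a weight function. -/
noncomputable def toS53 (f : ℕ → ℕ) (T : MonSet) : S53 :=
  if T.AllEq f 0 then .one else if T.AllLe f then .a else .inf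

theorem isHom_toS7 (f : ℕ → ℕ) : IsHom (toS7 f) := by
  classical
  constructor <;> intro S T <;>
    have hS := MonSet.AllEq.not_zero_one (f := f) (S := S) <;>
    have hT := MonSet.AllEq.not_zero_one (f := f) (S := T) <;>
    rw [toS7, toS7, toS7]
  · rw [if_congr MonSet.allEq_add rfl (if_congr MonSet.allEq_add rfl rfl)]
    by_cases S.AllEq f 0 <;> by_cases T.AllEq f 0 <;> by_cases S.AllEq f 1 <;>
      by_cases T.AllEq f 1 <;> simp_all <;> rfl
  · rw [if_congr MonSet.allEq_zero_mul rfl (if_congr MonSet.allEq_one_mul rfl rfl)]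
    by_cases S.AllEq f 0 <;> by_cases T.AllEq f 0 <;> by_cases S.AllEq f 1 <;>
      by_cases T.AllEq f 1 <;> simp_all <;> rfl

theorem isHom_toS53 (f : ℕ → ℕ) : IsHom (toS53 f) := by
  classical
  constructor <;> intro S T <;>
    have hS := MonSet.AllEq.allLe (f := f) (S := S) <;>
    have hT := MonSet.AllEq.allLe (f := f) (S := T) <;>
    rw [toS53, toS53, toS53]
  · rw [if_congr MonSet.allEq_add rfl (if_congr MonSet.allLe_add rfl rfl)]
    by_cases S.AllEq f 0 <;> by_cases T.AllEq f 0 <;> by_cases S.AllLe f <;>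
      by_cases T.AllLe f <;> simp_all <;> rfl
  · rw [if_congr MonSet.allEq_zero_mul rfl (if_congr MonSet.allLe_mul rfl rfl)]
    by_cases S.AllEq f 0 <;> by_cases T.AllEq f 0 <;> by_cases S.AllLe f <;>
      by_cases T.AllLe f <;> simp_all <;> rfl

theorem toS7_eq_a : toS7 f T = .a ↔ T.AllEq f 1 := by
  have hT := MonSet.AllEq.not_zero_one (f := f) (S := T)
  unfold toS7
  split_ifs <;> simp_all

theorem toS53_ne_inf : toS53 f T ≠ .inf ↔ T.AllLe f := by
  have hT := MonSet.AllEq.allLe (f := f) (S := T)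
  unfold toS53
  split_ifs <;> simp_all

/-- The factor `M` will be a single monomial `m`: the syntactic congruence tests sets only after
translation by `m`. -/
theorem Satisfies.allEq_one {e : SRTerm × SRTerm} (h : Satisfies S7 e) (f : ℕ → ℕ) (M : MonSet)
    (θ : ℕ → MonSet) : (M * e.1.eval θ).AllEq f 1 → (M * e.2.eval θ).AllEq f 1 := by
  rw [← toS7_eq_a, ← toS7_eq_a, (isHom_toS7 f).2, (isHom_toS7 f).2, (isHom_toS7 f).eval,
    (isHom_toS7 f).eval, h]
  exact id

theorem Satisfies.allLe_one {e : SRTerm × SRTerm} (h : Satisfies S53 e) (f : ℕ → ℕ) (M : MonSet)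
    (θ : ℕ → MonSet) : (M * e.1.eval θ).AllLe f → (M * e.2.eval θ).AllLe f := by
  rw [← toS53_ne_inf, ← toS53_ne_inf, (isHom_toS53 f).2, (isHom_toS53 f).2, (isHom_toS53 f).eval,
    (isHom_toS53 f).eval, h]
  exact id

/-! ### Bounded selections -/

/-- The number of occurrences of variables in a term. -/
def SRTerm.size : SRTerm → ℕ
  | .var _ => 1
  | .add s t => s.size + t.size
  | .mul s t => s.size + t.size

/-- A bound for the number of monomials in the value of a term, when each variable takes a value
with at most `c` monomials. -/
def SRTerm.cardBound (c : ℕ) : SRTerm → ℕ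
  | .var _ => c
  | .add s t => s.cardBound c + t.cardBound c
  | .mul s t => s.cardBound c * t.cardBound c

theorem SRTerm.card_eval_le {c : ℕ} {θ : ℕ → MonSet} (h : ∀ n, (θ n).supp.card ≤ c)
    (t : SRTerm) : (t.eval θ).supp.card ≤ t.cardBound c := by
  induction t with
  | var n => exact h n
  | add s t hs ht => exact (Finset.card_union_le _ _).trans (Nat.add_le_add hs ht)
  | mul s t hs ht => exact (Finset.card_image₂_le _ _ _).trans (Nat.mul_le_mul hs ht)

theorem SRTerm.supp_eval_mono {θ η : ℕ → MonSet} (h : ∀ n, (η n).supp ⊆ (θ n).supp)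
    (t : SRTerm) : (t.eval η).supp ⊆ (t.eval θ).supp := by
  induction t with
  | var n => exact h n
  | add s t hs ht => exact Finset.union_subset_union hs ht
  | mul s t hs ht => exact Finset.image₂_subset hs ht

/-- One monomial of the value arises from one choice of monomial per variable occurrence, so small
subsets of the values of the variables already produce it. The bound does not depend on `θ`. -/
theorem SRTerm.exists_selection (θ : ℕ → MonSet) (t : SRTerm) :
    ∀ w ∈ (t.eval θ).supp, ∃ η : ℕ → MonSet, (∀ n, (η n).supp ⊆ (θ n).supp) ∧
      (∀ n, (η n).supp.card ≤ t.size) ∧ w ∈ (t.eval η).supp := by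
  induction t with
  | var k =>
    intro w hw
    choose g hg using fun n => (θ n).nonempty
    -- The variables other than `k` are irrelevant, but their values must stay nonempty; `g n` is an
    -- arbitrary element.
    refine ⟨fun n => if n = k then .single w else .single (g n), fun n => ?_, fun n => ?_, ?_⟩
    · dsimp only
      split_ifs with h
      · subst h; exact Finset.singleton_subset_iff.2 hw
      · exact Finset.singleton_subset_iff.2 (hg n)
    · dsimp only
      split_ifs <;> exact (Finset.card_singleton _).le
    · simp [SRTerm.eval, MonSet.single]
  | add s t hs ht =>
    intro w hw
    rcases Finset.mem_union.1 hw with hw | hw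
    · obtain ⟨η, h1, h2, h3⟩ := hs w hw
      exact ⟨η, h1, fun n => (h2 n).trans (Nat.le_add_right _ _), Finset.mem_union_left _ h3⟩
    · obtain ⟨η, h1, h2, h3⟩ := ht w hw
      exact ⟨η, h1, fun n => (h2 n).trans (Nat.le_add_left _ _), Finset.mem_union_right _ h3⟩
  | mul s t hs ht =>
    intro w hw
    obtain ⟨x, hx, y, hy, rfl⟩ := MonSet.mem_mul.1 hw
    obtain ⟨η, h1, h2, h3⟩ := hs x hx
    obtain ⟨ζ, k1, k2, k3⟩ := ht y hy
    refine ⟨fun n => η n + ζ n, fun n => Finset.union_subset (h1 n) (k1 n), fun n =>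
      (Finset.card_union_le _ _).trans (Nat.add_le_add (h2 n) (k2 n)), ?_⟩
    exact MonSet.mem_mul.2 ⟨x, SRTerm.supp_eval_mono (fun _ => Finset.subset_union_left) s h3,
      y, SRTerm.supp_eval_mono (fun _ => Finset.subset_union_right) t k3, rfl⟩

/-! ### A cycle with one thick edge -/

/-- The edges of a path on `0, …, N`, and the triple that joins its ends to `N + 1`. -/
def cycleSet (N : ℕ) : Set (Multiset ℕ) :=
  {w | (∃ i < N, w = {i, i + 1}) ∨ w = {0, N, N + 1}}

theorem forall_cycleSet {N : ℕ} {f : ℕ → ℕ} {P : ℕ → Prop}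
    (h1 : ∀ i < N, P (f i + f (i + 1))) (h2 : P (f 0 + (f N + f (N + 1)))) :
    ∀ w ∈ cycleSet N, P (weight f w) := by
  rintro w (⟨i, hi, rfl⟩ | rfl)
  · simpa [weight] using h1 i hi
  · simpa [weight] using h2

theorem apply_le_weight {f : ℕ → ℕ} {i : ℕ} {w : Multiset ℕ} (h : i ∈ w) : f i ≤ weight f w := by
  obtain ⟨v, rfl⟩ := Multiset.exists_cons_of_mem h
  rw [weight_cons]; omega

theorem exists_mem_of_weight_ne_zero {f : ℕ → ℕ} {w : Multiset ℕ} (h : weight f w ≠ 0) :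
    ∃ i ∈ w, f i ≠ 0 := by
  by_contra! hc
  exact h (Multiset.sum_eq_zero fun x hx => by
    obtain ⟨i, hi, rfl⟩ := Multiset.mem_map.1 hx
    exact hc i hi)

/-- A monomial that passes all weight tests passed by the cycle belongs to the cycle or is the
missing edge. -/
theorem mem_cycleSet_or_eq {N : ℕ} (hN : Odd N) (w : Multiset ℕ)
    (h1 : ∀ f, (∀ v ∈ cycleSet N, weight f v = 1) → weight f w = 1)
    (h2 : ∀ f, (∀ v ∈ cycleSet N, weight f v ≤ 1) → weight f w ≤ 1) :
    w ∈ cycleSet N ∨ w = {0, N} := by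
  -- Parity weights: each edge has one even and one odd end, and so does the pair 0, `N` as `N` is
  -- odd. Weight 2 rules out variables beyond `N + 1`.
  have key : ∀ r < 2, weight (fun k => if k ≤ N then (if k % 2 = r then 1 else 0) else
      if k = N + 1 then 0 else 2) w = 1 := by
    intro r hr
    rw [Nat.odd_iff] at hN
    refine h1 _ (forall_cycleSet (P := (· = 1)) (fun i hi => ?_) ?_)
    · split_ifs <;> omega
    · split_ifs <;> omega
  -- The indicator of two variables that share no monomial of the cycle is at most 1 on the cycle,
  -- so such a pair cannot occur in `w`.
  have hadj : ∀ i ∈ w, ∀ j ∈ w, i ≠ j → (i + 1 = j ∧ j ≤ N) ∨ (j + 1 = i ∧ i ≤ N) ∨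
      ((i = 0 ∨ i = N ∨ i = N + 1) ∧ (j = 0 ∨ j = N ∨ j = N + 1)) := by
    intro i hi j hj hij
    by_contra hc
    have := h2 (fun k => if k = i ∨ k = j then 1 else 0)
      (forall_cycleSet (P := (· ≤ 1)) (fun k hk => by split_ifs <;> omega)
        (by rw [Nat.odd_iff] at hN; split_ifs <;> omega))
    obtain ⟨v, rfl⟩ := Multiset.exists_cons_of_mem hi
    have hj' := apply_le_weight (f := fun k => if k = i ∨ k = j then 1 else 0)
      ((Multiset.mem_cons.1 hj).resolve_left hij.symm)
    rw [weight_cons] at this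
    simp only [true_or, or_true, if_true] at this hj'
    omega
  have hw0 := key 0 (by omega)
  have hw1 := key 1 (by omega)
  obtain ⟨i, hi, hi0⟩ := exists_mem_of_weight_ne_zero (hw0.trans_ne one_ne_zero)
  obtain ⟨j, hj, hj0⟩ := exists_mem_of_weight_ne_zero (hw1.trans_ne one_ne_zero)
  have hi1 := (apply_le_weight hi).trans_eq hw0
  have hj1 := (apply_le_weight hj).trans_eq hw1
  have hi' : i ≤ N ∧ i % 2 = 0 := by split_ifs at hi0 hi1 <;> omega
  have hj' : j ≤ N ∧ j % 2 = 1 := by split_ifs at hj0 hj1 <;> omega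
  have hij : i ≠ j := by rintro rfl; omega
  obtain ⟨v, rfl⟩ := Multiset.exists_cons_of_mem hi
  obtain ⟨v, rfl⟩ := Multiset.exists_cons_of_mem ((Multiset.mem_cons.1 hj).resolve_left hij.symm)
  -- The variables `i` and `j` use up both parity weights, so only the weightless variable `N + 1`
  -- is left.
  have hv : ∀ k ∈ v, k = N + 1 := by
    intro k hk
    have e0 := apply_le_weight (f := fun k => if k ≤ N then (if k % 2 = 0 then 1 else 0) else
      if k = N + 1 then 0 else 2) hk
    have e1 := apply_le_weight (f := fun k => if k ≤ N then (if k % 2 = 1 then 1 else 0) else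
      if k = N + 1 then 0 else 2) hk
    rw [weight_cons, weight_cons] at hw0 hw1
    simp only [hi'.1, hi'.2, hj'.1, hj'.2, if_true] at hw0 hw1
    split_ifs at e0 e1 <;> omega
  have hc : weight (fun k => if k = N + 1 then 1 else 0) v ≤ 1 := by
    have := h2 (fun k => if k = N + 1 then 1 else 0)
      (forall_cycleSet (P := (· ≤ 1)) (fun k hk => by split_ifs <;> omega)
        (by split_ifs <;> first | contradiction | omega))
    rw [weight_cons, weight_cons] at this
    omega
  rw [Multiset.eq_replicate_card.2 hv] at hc
  simp only [weight, Multiset.map_replicate, Multiset.sum_replicate, if_true, smul_eq_mul,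
    mul_one] at hc
  have hadj1 := hadj i hi j hj hij
  rcases Multiset.empty_or_exists_mem v with rfl | ⟨k, hk⟩
  · rcases hadj1 with h | h | h
    · exact Or.inl (Or.inl ⟨i, by omega, by rw [← h.1.symm]; rfl⟩)
    · refine Or.inl (Or.inl ⟨j, by omega, ?_⟩)
      rw [h.1]
      exact Multiset.cons_swap _ _ _
    · right
      obtain rfl : i = 0 := by rw [Nat.odd_iff] at hN; omega
      obtain rfl : j = N := by omega
      rfl
  · obtain rfl := hv k hk
    obtain ⟨v', rfl⟩ := Multiset.exists_cons_of_mem hk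
    rw [Multiset.card_cons] at hc
    obtain rfl : v' = 0 := Multiset.card_eq_zero.1 (by omega)
    -- The variable `N + 1` lies only in the closing monomial, so `i` and `j` must be its other two
    -- variables, 0 and `N`.
    have e1 := hadj i hi (N + 1) (by simp) (by omega)
    have e2 := hadj j hj (N + 1) (by simp) (by omega)
    rw [Nat.odd_iff] at hN
    obtain rfl : i = 0 := by omega
    obtain rfl : j = N := by omega
    exact Or.inl (Or.inr rfl)

/-- Few monomials of the cycle cannot force the missing edge. -/
theorem exists_weight_eq_one {N : ℕ} (hN : Odd N) (T : Finset (Multiset ℕ))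
    (hT : ↑T ⊆ cycleSet N) (hc : T.card < N) :
    ∃ f, (∀ t ∈ T, weight f t = 1) ∧ weight f {0, N} = 0 := by
  obtain ⟨i, hi, hiT⟩ : ∃ i < N, ({i, i + 1} : Multiset ℕ) ∉ T := by
    by_contra! h
    have hinj : Function.Injective fun i : ℕ => ({i, i + 1} : Multiset ℕ) := by
      intro i j hij
      have := congrArg Multiset.sum hij
      simp only [Multiset.insert_eq_cons, Multiset.sum_cons, Multiset.sum_singleton] at this
      omega
    have := Finset.card_le_card (s := (Finset.range N).image fun i : ℕ => ({i, i + 1} : Multiset ℕ))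
      (t := T) (Finset.image_subset_iff.2 fun i hi => h i (Finset.mem_range.1 hi))
    rw [Finset.card_image_of_injective _ hinj, Finset.card_range] at this
    omega
  rw [Nat.odd_iff] at hN
  -- Weights alternate from 0 at vertex 0 up to the absent edge, where the phase flips; hence vertex
  -- `N`, of odd index, also gets 0. The weight of the closing monomial comes from `N + 1` alone.
  refine ⟨fun k => if k = N + 1 then 1 else if k ≤ i then k % 2 else (k + 1) % 2, ?_, ?_⟩
  · intro t ht
    rcases hT ht with ⟨k, hk, rfl⟩ | rfl
    · have hki : k ≠ i := by rintro rfl; exact hiT ht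
      simp only [weight, Multiset.insert_eq_cons, Multiset.map_cons, Multiset.map_singleton,
        Multiset.sum_cons, Multiset.sum_singleton]
      split_ifs <;> first | contradiction | omega
    · simp only [weight, Multiset.insert_eq_cons, Multiset.map_cons, Multiset.map_singleton,
        Multiset.sum_cons, Multiset.sum_singleton]
      split_ifs <;> first | contradiction | omega
  · simp only [weight, Multiset.insert_eq_cons, Multiset.map_cons, Multiset.map_singleton,
      Multiset.sum_cons, Multiset.sum_singleton]
    split_ifs <;> first | contradiction | omega

theorem missing_notMem_cycleSet {N : ℕ} (hN : 1 < N) : ({0, N} : Multiset ℕ) ∉ cycleSet N := by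
  rintro (⟨i, -, h⟩ | h)
  · have h0 : (0 : ℕ) ∈ ({i, i + 1} : Multiset ℕ) := h ▸ by simp
    have h1 : N ∈ ({i, i + 1} : Multiset ℕ) := h ▸ by simp
    simp at h0 h1
    omega
  · exact absurd (congrArg Multiset.card h) (by simp)

/-! ### The algebra that separates long identities from short ones -/

/-- The monomial `m` multiplies `T` into the cycle. -/
def MonSet.MulInto (N : ℕ) (m : Multiset ℕ) (T : MonSet) : Prop :=
  ∀ t ∈ T.supp, m + t ∈ cycleSet N

theorem MonSet.mulInto_mul {N : ℕ} {m : Multiset ℕ} {S T : MonSet} :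
    (S * T).MulInto N m ↔ ∀ s ∈ S.supp, T.MulInto N (m + s) := by
  simp only [MulInto, supp_mul, Finset.forall_mem_image₂, add_assoc]

theorem MonSet.mulInto_mul' {N : ℕ} {m : Multiset ℕ} {S T : MonSet} :
    (S * T).MulInto N m ↔ ∀ t ∈ T.supp, S.MulInto N (m + t) := by
  rw [mulInto_mul]
  simp only [MulInto]
  refine ⟨fun h t ht s hs => ?_, fun h s hs t ht => ?_⟩
  · rw [add_right_comm]; exact h s hs t ht
  · rw [add_right_comm]; exact h t ht s hs

theorem MonSet.mulInto_add {N : ℕ} {m : Multiset ℕ} {S T : MonSet} :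
    (S + T).MulInto N m ↔ S.MulInto N m ∧ T.MulInto N m := by
  simp only [MulInto, supp_add, Finset.forall_mem_union]

/-- By the weight tests, a monomial of the right side, multiplied by `m`, can leave the cycle only
as the missing edge. A selection that still yields this monomial gives the left side fewer than `N`
monomials, too few to force the missing edge. -/
theorem MonSet.mulInto_eval {N : ℕ} (hN : Odd N) {p q : SRTerm} (h7 : Satisfies S7 (p, q))
    (h53 : Satisfies S53 (p, q)) (hb : p.cardBound q.size < N) (θ : ℕ → MonSet) (m : Multiset ℕ)
    (h : (p.eval θ).MulInto N m) : (q.eval θ).MulInto N m := by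
  intro w hw
  have hmul : ∀ {P : ℕ → Prop} {f : ℕ → ℕ} {T : MonSet},
      (∀ t ∈ (single m * T).supp, P (weight f t)) ↔ ∀ t ∈ T.supp, P (weight f (m + t)) := by
    intro P f T
    rw [forall_mul]
    simp [single, weight_add]
  refine (mem_cycleSet_or_eq hN (m + w) (fun f hf => ?_) fun f hf => ?_).resolve_right fun hw0 => ?_
  · exact (hmul (P := (· = 1))).1 (h7.allEq_one f (single m) θ
      ((hmul (P := (· = 1))).2 fun t ht => hf _ (h t ht))) w hw
  · exact (hmul (P := (· ≤ 1))).1 (h53.allLe_one f (single m) θ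
      ((hmul (P := (· ≤ 1))).2 fun t ht => hf _ (h t ht))) w hw
  · obtain ⟨η, hsub, hcard, hwη⟩ := q.exists_selection θ w hw
    obtain ⟨f, hf, hf0⟩ := exists_weight_eq_one hN ((p.eval η).supp.image (m + ·))
      (by
        intro x hx
        obtain ⟨t, ht, rfl⟩ := Finset.mem_image.1 (Finset.mem_coe.1 hx)
        exact h t (p.supp_eval_mono hsub ht))
      ((Finset.card_image_le.trans (p.card_eval_le hcard)).trans_lt hb)
    have h1 : (single m * q.eval η).AllEq f 1 := h7.allEq_one f (single m) η
      ((hmul (P := (· = 1))).2 fun t ht => hf _ (Finset.mem_image_of_mem _ ht))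
    have := (hmul (P := (· = 1))).1 h1 w hwη
    rw [hw0, hf0] at this
    omega

/-- Sets of monomials are identified when the same monomials multiply them into the cycle. -/
def cycleSetoid (N : ℕ) : Setoid MonSet where
  r S T := ∀ m, S.MulInto N m ↔ T.MulInto N m
  iseqv := ⟨fun _ _ => Iff.rfl, fun h m => (h m).symm, fun h k m => (h m).trans (k m)⟩

/-- The syntactic quotient of the sets of monomials by the cycle. -/
def CycleAlg (N : ℕ) : Type := Quotient (cycleSetoid N)

instance (N : ℕ) : Nonempty (CycleAlg N) := ⟨Quotient.mk _ (.single 0)⟩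

instance (N : ℕ) : Add (CycleAlg N) :=
  ⟨Quotient.map₂ (· + ·) fun S S' hS T T' hT m => by
    rw [MonSet.mulInto_add, MonSet.mulInto_add, hS m, hT m]⟩

instance (N : ℕ) : Mul (CycleAlg N) :=
  ⟨Quotient.map₂ (· * ·) fun S S' hS T T' hT m => by
    -- The factors are replaced one at a time, the monomials of the other factor being absorbed into
    -- the translation.
    rw [MonSet.mulInto_mul, forall₂_congr fun s _ => hT (m + s), ← MonSet.mulInto_mul,
      MonSet.mulInto_mul', forall₂_congr fun t _ => hS (m + t), ← MonSet.mulInto_mul']⟩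

/-- The class of a set of monomials. -/
def CycleAlg.mk (N : ℕ) (T : MonSet) : CycleAlg N := Quotient.mk _ T

theorem CycleAlg.isHom_mk (N : ℕ) : IsHom (mk N) := ⟨fun _ _ => rfl, fun _ _ => rfl⟩

theorem CycleAlg.mk_surjective (N : ℕ) : Function.Surjective (mk N) := Quotient.mk_surjective

theorem CycleAlg.satisfies {N : ℕ} (hN : Odd N) {p q : SRTerm} (h7 : Satisfies S7 (p, q))
    (h53 : Satisfies S53 (p, q)) (hpq : p.cardBound q.size < N) (hqp : q.cardBound p.size < N) :
    Satisfies (CycleAlg N) (p, q) := by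
  intro φ
  obtain ⟨θ, rfl⟩ := (mk_surjective N).comp_left φ
  have h : mk N (p.eval θ) = mk N (q.eval θ) := Quotient.sound fun m =>
    ⟨MonSet.mulInto_eval hN h7 h53 hpq θ m, MonSet.mulInto_eval hN (fun ψ => (h7 ψ).symm)
      (fun ψ => (h53 ψ).symm) hqp θ m⟩
  rw [(isHom_mk N).eval, (isHom_mk N).eval] at h
  exact h

/-! ### The cycle identity -/

/-- The term `x₀x₁ + x₁x₂ + ⋯ + xₙxₙ₊₁`. -/
def pathTerm : ℕ → SRTerm
  | 0 => .mul (.var 0) (.var 1)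
  | n + 1 => .add (pathTerm n) (.mul (.var (n + 1)) (.var (n + 2)))

/-- The sum of the monomials of the cycle on `0, …, n + 1`. -/
def cycleTerm (n : ℕ) : SRTerm :=
  .add (pathTerm n) (.mul (.mul (.var 0) (.var (n + 1))) (.var (n + 2)))

/-- Adjoining the missing edge to the cycle. -/
def cycleIdentity (n : ℕ) : SRTerm × SRTerm :=
  (cycleTerm n, .add (cycleTerm n) (.mul (.var 0) (.var (n + 1))))

/-- A sum in `S7` other than `∞` has all summands equal. If the edges all equal 1, so do all the
variables; if they all equal `a`, the variables alternate between 1 and `a`. The number of edges is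
odd, so the product of the two ends is again the common value. -/
theorem eval_pathTerm_S7 (φ : ℕ → S7) (k : ℕ) :
    (pathTerm (2 * k)).eval φ = .inf ∨ (pathTerm (2 * k)).eval φ = φ 0 * φ (2 * k + 1) := by
  induction k with
  | zero => exact Or.inr rfl
  | succ k ih =>
    have key : ∀ p x b c d : S7, p = .inf ∨ p = x * b →
        p + b * c + c * d = .inf ∨ p + b * c + c * d = x * d := by
      rintro p (_ | _) (_ | _) (_ | _) (_ | _) (rfl | rfl) <;>
        first | exact Or.inl rfl | exact Or.inr rfl
    exact key _ _ _ _ (φ (2 * k + 3)) ih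

theorem satisfies_cycleIdentity_S7 (k : ℕ) : Satisfies S7 (cycleIdentity (2 * k)) := by
  intro φ
  have key : ∀ p x b c : S7, p = .inf ∨ p = x * b → p + x * b * c = p + x * b * c + x * b := by
    rintro p (_ | _) (_ | _) (_ | _) (rfl | rfl) <;> rfl
  exact key _ _ _ _ (eval_pathTerm_S7 φ k)

/-- In the order of `S53` given by `+`, 1 is the least element, so `x * b` lies below `x * b * c`
and is absorbed; the path plays no role. -/
theorem satisfies_cycleIdentity_S53 (n : ℕ) : Satisfies S53 (cycleIdentity n) := by
  intro φ
  have key : ∀ p x b c : S53, p + x * b * c = p + x * b * c + x * b := by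
    rintro (_ | _) (_ | _) (_ | _) (_ | _) <;> rfl
  exact key _ _ _ _

theorem mulInto_pathTerm {n N : ℕ} (h : n < N) :
    ((pathTerm n).eval fun i => MonSet.single {i}).MulInto N 0 := by
  have aux : ∀ i < N, (MonSet.single {i} * MonSet.single {i + 1}).MulInto N 0 := by
    intro i hi
    simp only [MonSet.MulInto, MonSet.supp_mul, MonSet.single, Finset.image₂_singleton,
      Finset.mem_singleton, forall_eq, zero_add]
    exact Or.inl ⟨i, hi, rfl⟩
  induction n with
  | zero => exact aux 0 h
  | succ n ih => exact MonSet.mulInto_add.2 ⟨ih (by omega), aux (n + 1) h⟩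

theorem not_satisfies_cycleIdentity {n : ℕ} (hn : 0 < n) :
    ¬ Satisfies (CycleAlg (n + 1)) (cycleIdentity n) := by
  intro h
  have h := h fun i => CycleAlg.mk (n + 1) (.single {i})
  rw [← (CycleAlg.isHom_mk (n + 1)).eval, ← (CycleAlg.isHom_mk (n + 1)).eval] at h
  -- The translation by the empty monomial 0 already separates the two sides.
  have h := (Quotient.exact h : ∀ m, _ ↔ _) 0
  have h1 : ((cycleTerm n).eval fun i => MonSet.single {i}).MulInto (n + 1) 0 := by
    refine MonSet.mulInto_add.2 ⟨mulInto_pathTerm (by omega), ?_⟩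
    simp only [MonSet.MulInto, SRTerm.eval, MonSet.supp_mul, MonSet.single,
      Finset.image₂_singleton, Finset.mem_singleton, forall_eq, zero_add]
    exact Or.inr rfl
  have h2 := (MonSet.mulInto_add.1 (h.1 h1)).2 {0, n + 1} (by
    simp only [SRTerm.eval, MonSet.supp_mul, MonSet.single,
      Finset.image₂_singleton, Finset.mem_singleton]
    rfl)
  rw [zero_add] at h2
  exact missing_notMem_cycleSet (by omega) h2

theorem not_isFinitelyBased_S4_359 : ¬ IsFinitelyBased S4_359 := by
  rintro ⟨E, hE, hV⟩
  have hsat := isSubdirectProduct_S4_359.satisfies_iff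
  have hA : ∀ e ∈ E, Satisfies S4_359 e := by
    have := mem_varietyOf_self S4_359
    rw [hV] at this
    exact this
  obtain ⟨K, hK⟩ := (hE.image fun e =>
    max (e.1.cardBound e.2.size) (e.2.cardBound e.1.size)).bddAbove
  -- The length `2 * (K + 1) + 1` is odd and exceeds the bound `K` for both directions of every
  -- identity in `E`.
  have hB : (⟨CycleAlg (2 * (K + 1) + 1)⟩ : Alg) ∈ varietyOf S4_359 := by
    rw [hV]
    intro e he
    have hb := max_le_iff.1 (hK (Set.mem_image_of_mem _ he))
    have hs := (hsat e).1 (hA e he)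
    exact CycleAlg.satisfies (odd_two_mul_add_one _) hs.1 hs.2 (by omega) (by omega)
  exact not_satisfies_cycleIdentity (n := 2 * (K + 1)) (by omega)
    (satisfies_of_mem_varietyOf hB
      ((hsat _).2 ⟨satisfies_cycleIdentity_S7 _, satisfies_cycleIdentity_S53 _⟩))

theorem varietyOf_eq : varietyOf S4_359 = varietyOf S4_123 := by
  ext B
  refine forall₂_congr fun K hK => ?_
  rw [isSubdirectProduct_S4_359.mem_iff hK, isSubdirectProduct_S4_123.mem_iff hK]

end AiSR

theorem mainTheorem12 :
    (AiSR.IsAiSemiring AiSR.S7 ∧ AiSR.IsAiSemiring AiSR.S53 ∧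
      AiSR.IsAiSemiring AiSR.S4_123 ∧ AiSR.IsAiSemiring AiSR.S4_359) ∧
    ¬ AiSR.IsFinitelyBased AiSR.S4_359 ∧
    AiSR.IsSubdirectProduct AiSR.S4_359 AiSR.S7 AiSR.S53 ∧
    AiSR.IsSubdirectProduct AiSR.S4_123 AiSR.S7 AiSR.S53 ∧
    AiSR.varietyOf AiSR.S4_359 = AiSR.varietyOf AiSR.S4_123 :=
  ⟨⟨AiSR.isAiSemiring_S7, AiSR.isAiSemiring_S53,
    AiSR.isSubdirectProduct_S4_123.isAiSemiring AiSR.isAiSemiring_S7 AiSR.isAiSemiring_S53,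
    AiSR.isSubdirectProduct_S4_359.isAiSemiring AiSR.isAiSemiring_S7 AiSR.isAiSemiring_S53⟩,
    AiSR.not_isFinitelyBased_S4_359, AiSR.isSubdirectProduct_S4_359,
    AiSR.isSubdirectProduct_S4_123, AiSR.varietyOf_eq⟩
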